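/- Let $X$ and $Y$ be complex Banach spaces and let $S\in L(X)$, $T\in L(Y)$ be bounded linear operators. For a bounded operator $A$ on a complex Banach space $Z$, let $N(A)$ and $R(A)$ be its null space and range, $\alpha(A)=\dim N(A)$, $\beta(A)=\operatorname{codim}R(A)$, and let $a(A)=\inf\{n\ge 0: N(A^n)=N(A^{n+1})\}$ be the ascent ($\inf\emptyset=\infty$). Let $\sigma(A)$ be the spectrum, and let $\sigma_a(A)$ be the approximate spectrum, i.e. the set of $\lambda$ such that $A-\lambda I$ is not bounded below. $A$ is upper semi-Weyl if $R(A)$ is closed, $\alpha(A)<\infty$ and $\operatorname{ind}A=\alpha(A)-\beta(A)\le 0$ (with value $-\infty$ allowed); $\sigma_{uw}(A)$ is the set of $\lambda\in\mathbb C$ such that $A-\lambda I$ is not upper semi-Weyl. Put $$\pi_{00}^a(A)=\{\lambda : \lambda \text{ is an isolated point of }\sigma_a(A),\ 0<\alpha(A-\lambda I)<\infty\},$$ $$p_{00}^a(A)=\{\lambda\in\sigma_a(A): p=a(A-\lambda I)<\infty,\ R((A-\lambda I)^{p+1})\text{ is closed},\ \alpha(A-\lambda I)<\infty\}.$$ $A$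 satisfies property $(z)$ if $\sigma(A)\setminus\sigma_{uw}(A)=\pi_{00}^a(A)$, and property $(az)$ if $\sigma(A)\setminus\sigma_{uw}(A)=p_{00}^a(A)$. With $H_0(A)=\{x\in Z:\lim_{n\to\infty}\|A^nx\|^{1/n}=0\}$, $A$ is an $(H)$-operator if for every $\lambda\in\mathbb C$ there is $p=p(\lambda)\in\mathbb N$ with $H_0(A-\lambda I)=N((A-\lambda I)^p)$. Suppose that $S$ and $T$ are $(H)$-operators. If $S$ and $T$ both satisfy property $(az)$, then $S\oplus T\in L(X\oplus Y)$ satisfies property $(az)$. If $S$ and $T$ both satisfy property $(z)$, then $S\oplus T$ satisfies property $(z)$. -/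

import Mathlib

open Filter Topology

noncomputable section

namespace BddOp

variable {X : Type*} [NormedAddCommGroup X] [NormedSpace ℂ X]

/-- The operator `T - λ I`. -/
def shift (T : X →L[ℂ] X) (z : ℂ) : X →L[ℂ] X := T - z • (1 : X →L[ℂ] X)

/-- The null space `N(T)`. -/
def ker (T : X →L[ℂ] X) : Submodule ℂ X := LinearMap.ker (T : X →ₗ[ℂ] X)

/-- The range `R(T)`. -/
def range (T : X →L[ℂ] X) : Submodule ℂ X := LinearMap.range (T : X →ₗ[ℂ] X)

/-- `α(T)`, the dimension of the null space; it is `⊤` when infinite. -/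
def alpha (T : X →L[ℂ] X) : ℕ∞ := Cardinal.toENat (Module.rank ℂ (ker T))

/-- `β(T)`, the codimension of the range; it is `⊤` when infinite. -/
def beta (T : X →L[ℂ] X) : ℕ∞ := Cardinal.toENat (Module.rank ℂ (X ⧸ range T))

/-- The index `α(T) - β(T)` as an extended real. It is meaningful as soon as `α(T)` or `β(T)`
is finite, and is only used for such operators. -/
def index (T : X →L[ℂ] X) : EReal := (alpha T : EReal) - (beta T : EReal)

/-- The ascent `inf {n | N(T^n) = N(T^(n+1))}`, with `inf ∅ = ⊤`. -/
def ascent (T : X →L[ℂ] X) : ℕ∞ :=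
  sInf ((fun n : ℕ => (n : ℕ∞)) '' {n : ℕ | ker (T ^ n) = ker (T ^ (n + 1))})

/-- Closed range and finite dimensional null space. -/
def IsUpperSemiFredholm (T : X →L[ℂ] X) : Prop :=
  IsClosed (range T : Set X) ∧ alpha T < ⊤

/-- Upper semi-Fredholm of index `≤ 0`. -/
def IsUpperSemiWeyl (T : X →L[ℂ] X) : Prop :=
  IsUpperSemiFredholm T ∧ index T ≤ 0

def IsBoundedBelow (T : X →L[ℂ] X) : Prop :=
  ∃ c : ℝ, 0 < c ∧ ∀ x : X, c * ‖x‖ ≤ ‖T x‖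

/-- The approximate (point) spectrum `σ_a(T)`. -/
def approxSpectrum (T : X →L[ℂ] X) : Set ℂ := {z | ¬ IsBoundedBelow (shift T z)}

/-- The upper semi-Weyl spectrum `σ_uw(T)`. -/
def upperSemiWeylSpectrum (T : X →L[ℂ] X) : Set ℂ := {z | ¬ IsUpperSemiWeyl (shift T z)}

/-- The eigenvalues of finite (geometric) multiplicity, `σ_p^0(T)`. -/
def finiteEigenvalues (T : X →L[ℂ] X) : Set ℂ :=
  {z | Module.End.HasEigenvalue (T : X →ₗ[ℂ] X) z ∧ alpha (shift T z) < ⊤}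

/-- The isolated points of a set of complex numbers. -/
def isoPoints (A : Set ℂ) : Set ℂ := {z | z ∈ A ∧ ¬ AccPt z (𝓟 A)}

/-- `π_00^a(T) = iso σ_a(T) ∩ σ_p^0(T)`. -/
def pi00a (T : X →L[ℂ] X) : Set ℂ := isoPoints (approxSpectrum T) ∩ finiteEigenvalues T

/-- The left poles `p_0^a(T)`: points of `σ_a(T)` at which `T - λ I` has finite ascent `p` and
`R((T - λ I)^(p+1))` is closed. -/
def leftPoles (T : X →L[ℂ] X) : Set ℂ :=
  {z | z ∈ approxSpectrum T ∧ ∃ p : ℕ, ascent (shift T z) = (p : ℕ∞) ∧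
    IsClosed (range (shift T z ^ (p + 1)) : Set X)}

/-- The left poles of finite rank `p_00^a(T)`: those with `α(T - λ I) < ∞`. -/
def p00a (T : X →L[ℂ] X) : Set ℂ := {z | z ∈ leftPoles T ∧ alpha (shift T z) < ⊤}

/-- Property `(z)`. -/
def PropertyZ (T : X →L[ℂ] X) : Prop :=
  spectrum ℂ T \ upperSemiWeylSpectrum T = pi00a T

/-- Property `(az)`. -/
def PropertyAZ (T : X →L[ℂ] X) : Prop :=
  spectrum ℂ T \ upperSemiWeylSpectrum T = p00a T

/-- The quasinilpotent part `H_0(T)`. -/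
def quasinilpotentPart (T : X →L[ℂ] X) : Set X :=
  {x | Tendsto (fun n : ℕ => ‖(T ^ n) x‖ ^ (1 / (n : ℝ))) atTop (𝓝 0)}

/-- The class `(H)`; the exponent `p` may depend on the point. -/
def ClassH (T : X →L[ℂ] X) : Prop :=
  ∀ z : ℂ, ∃ p : ℕ, quasinilpotentPart (shift T z) = (ker (shift T z ^ p) : Set X)

end BddOp

end

open Filter Topology

namespace BddOp

variable {X : Type*} [NormedAddCommGroup X] [NormedSpace ℂ X]

/-! Since N((A-λ)^n) ⊆ H_0(A-λ), class (H) forces finite ascent at every λ. Finite ascent and finite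
nullity give α ≤ β, so upper semi-Weyl means upper semi-Fredholm, and the points of `p00a` are
exactly the upper semi-Fredholm points of σ_a. Hence (az) amounts to σ_a = σ (`propertyAZ_iff`),
which passes to direct sums because both spectra of S ⊕ T are unions.

For (z), σ_a = σ is again necessary, and the rest compares the upper semi-Fredholm points of σ with
its isolated eigenvalues of finite multiplicity. An isolated point of σ(S) ∪ σ(T) may be an
eigenvalue of only one summand, so the comparison does not split at once. The remedy is that
isolated spectral points of an (H)-operator are always eigenvalues: the Riesz projection maps into
H_0 = N((A-λ)^p). The eigenvalue condition then drops out (`ClassH.not_accPt_and_alpha_lt_top_iff`),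
and what remains holds for S ⊕ T exactly when it holds for both summands. -/

theorem mem_ker_iff {A : X →L[ℂ] X} {x : X} : x ∈ ker A ↔ A x = 0 := Iff.rfl

theorem alpha_lt_top_iff {A : X →L[ℂ] X} : alpha A < ⊤ ↔ FiniteDimensional ℂ (ker A) := by
  rw [alpha, Cardinal.toENat_lt_top, Module.rank_lt_aleph0_iff]

/-! ### Powers of operators: finite nullity and closed range. -/

theorem finiteDimensional_ker_pow {A : X →L[ℂ] X} (h : FiniteDimensional ℂ (ker A)) (n : ℕ) :
    FiniteDimensional ℂ (ker (A ^ n)) := by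
  induction n with
  | zero =>
    have : ker (A ^ 0) = ⊥ := by
      ext x; simp [mem_ker_iff]
    rw [this]; infer_instance
  | succ n ih =>
    rw [FiniteDimensional, Module.Finite.iff_fg] at *
    refine Submodule.fg_of_fg_map_of_fg_inf_ker (A : X →ₗ[ℂ] X) ?_ ?_
    · have : FiniteDimensional ℂ (ker (A ^ n)) := Module.Finite.iff_fg.2 ih
      have hle : (ker (A ^ (n + 1))).map (A : X →ₗ[ℂ] X) ≤ ker (A ^ n) := by
        rintro _ ⟨x, hx, rfl⟩
        exact hx
      exact Module.Finite.iff_fg.1 (Submodule.finiteDimensional_of_le hle)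
    · have : FiniteDimensional ℂ (ker A) := Module.Finite.iff_fg.2 h
      exact Module.Finite.iff_fg.1 (Submodule.finiteDimensional_of_le
        (inf_le_right : ker (A ^ (n + 1)) ⊓ ker A ≤ ker A))

/-- By the open mapping theorem A is a quotient map onto its closed range, and the preimage of A(M)
is M + N(A), a closed subspace plus a finite dimensional one. -/
theorem IsUpperSemiFredholm.isClosed_map [CompleteSpace X] {A : X →L[ℂ] X}
    (h : IsUpperSemiFredholm A) {M : Submodule ℂ X} (hM : IsClosed (M : Set X)) :
    IsClosed (M.map (A : X →ₗ[ℂ] X) : Set X) := by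
  obtain ⟨hc, hf⟩ := h
  rw [alpha_lt_top_iff] at hf
  have : CompleteSpace (range A) := hc.completeSpace_coe
  let f : X →L[ℂ] range A := A.codRestrict (range A) fun x => ⟨x, rfl⟩
  have hs : Function.Surjective f := by
    rintro ⟨_, x, rfl⟩
    exact ⟨x, rfl⟩
  have hq := f.isQuotientMap hs
  have hpre : f ⁻¹' (f '' (M : Set X)) = ((M ⊔ ker A : Submodule ℂ X) : Set X) := by
    ext x
    simp only [Set.mem_preimage, Set.mem_image, SetLike.mem_coe, Submodule.mem_sup]
    constructor
    · rintro ⟨m, hm, hx⟩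
      refine ⟨m, hm, x - m, ?_, by abel⟩
      have : A m = A x := congrArg Subtype.val hx
      rw [mem_ker_iff, map_sub, this, sub_self]
    · rintro ⟨m, hm, y, hy, rfl⟩
      refine ⟨m, hm, Subtype.ext ?_⟩
      rw [mem_ker_iff] at hy
      change A m = A (m + y)
      rw [map_add, hy, add_zero]
  have hcl : IsClosed (f '' (M : Set X)) := by
    rw [← hq.isClosed_preimage, hpre]
    exact Submodule.isClosed_sup_finiteDimensional M (ker A) hM
  have := hc.isClosedMap_subtype_val _ hcl
  rw [Set.image_image] at this
  exact this

theorem IsUpperSemiFredholm.pow [CompleteSpace X] {A : X →L[ℂ] X}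
    (h : IsUpperSemiFredholm A) (n : ℕ) : IsUpperSemiFredholm (A ^ n) := by
  refine ⟨?_, alpha_lt_top_iff.2 (finiteDimensional_ker_pow (alpha_lt_top_iff.1 h.2) n)⟩
  induction n with
  | zero =>
    have : (range (A ^ 0) : Set X) = Set.univ := Set.eq_univ_of_forall fun x => ⟨x, by simp⟩
    rw [this]
    exact isClosed_univ
  | succ n ih =>
    have : range (A ^ (n + 1)) = (range (A ^ n)).map (A : X →ₗ[ℂ] X) := by
      ext x
      simp [range, pow_succ']
    rw [this]
    exact h.isClosed_map ih

/-- On a closed complement C of N(A^(n+1)), A^(n+1) = A^n A is bounded below, hence so is A. Thus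
A(C) is closed, and R(A) is A(C) plus a finite dimensional space. -/
theorem isClosed_range_of_isClosed_range_pow_succ [CompleteSpace X] {A : X →L[ℂ] X}
    (h : FiniteDimensional ℂ (ker A)) {n : ℕ} (hn : IsClosed (range (A ^ (n + 1)) : Set X)) :
    IsClosed (range A : Set X) := by
  have hF := finiteDimensional_ker_pow h (n + 1)
  obtain ⟨C, hC, hFC⟩ :=
    (Submodule.ClosedComplemented.of_finiteDimensional (ker (A ^ (n + 1)))).exists_isClosed_isCompl
  have : CompleteSpace C := hC.completeSpace_coe
  let g : C →L[ℂ] X := (A ^ (n + 1)).comp C.subtypeL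
  have hg : Function.Injective g := by
    rw [injective_iff_map_eq_zero]
    rintro ⟨x, hx⟩ h0
    exact Subtype.ext (Submodule.disjoint_def.1 hFC.disjoint x h0 hx)
  have hgr : Set.range g = (range (A ^ (n + 1)) : Set X) := by
    ext y
    constructor
    · rintro ⟨x, rfl⟩
      exact ⟨x, rfl⟩
    · rintro ⟨x, rfl⟩
      have hx : x ∈ ker (A ^ (n + 1)) ⊔ C := hFC.sup_eq_top ▸ Submodule.mem_top
      obtain ⟨k, hk, c, hc, rfl⟩ := Submodule.mem_sup.1 hx
      refine ⟨⟨c, hc⟩, ?_⟩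
      rw [mem_ker_iff] at hk
      change (A ^ (n + 1)) c = (A ^ (n + 1)) (k + c)
      rw [map_add, hk, zero_add]
  obtain ⟨K, hK⟩ := g.antilipschitz_of_injective_of_isClosed_range hg (by rw [hgr]; exact hn)
  let a : C →L[ℂ] X := A.comp C.subtypeL
  have ha : AntilipschitzWith (K * ‖A ^ n‖₊) a := by
    refine AddMonoidHomClass.antilipschitz_of_bound a fun x => ?_
    have h1 := hK.le_mul_dist x 0
    rw [map_zero, dist_zero_right, dist_zero_right] at h1
    refine h1.trans ?_
    push_cast
    rw [mul_assoc]
    refine mul_le_mul_of_nonneg_left ?_ K.2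
    have : g x = (A ^ n) (a x) := rfl
    rw [this]
    exact (A ^ n).le_opNorm _
  have hcl : IsClosed (C.map (A : X →ₗ[ℂ] X) : Set X) := by
    have := ha.isClosed_range a.uniformContinuous
    convert this using 1
    ext y
    simp [a]
  have hr : range A = C.map (A : X →ₗ[ℂ] X) ⊔ (ker (A ^ (n + 1))).map (A : X →ₗ[ℂ] X) := by
    rw [← Submodule.map_sup, sup_comm, hFC.sup_eq_top, Submodule.map_top]
    rfl
  rw [hr]
  exact Submodule.isClosed_sup_finiteDimensional _ _ hcl

/-! ### Finite ascent and the sign of the index. -/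

/-- The kernels of the powers of `A` stabilize. -/
def HasFiniteAscent (A : X →L[ℂ] X) : Prop := ∃ p : ℕ, ∀ n : ℕ, ker (A ^ n) ≤ ker (A ^ p)

theorem HasFiniteAscent.exists_ascent_eq {A : X →L[ℂ] X} (h : HasFiniteAscent A) :
    ∃ p : ℕ, ascent A = p := by
  obtain ⟨p, hp⟩ := h
  have hle : ascent A ≤ p := by
    refine sInf_le ⟨p, le_antisymm (fun x hx => ?_) (hp _), rfl⟩
    rw [mem_ker_iff] at *
    rw [pow_succ', mul_apply_eq_comp, hx, map_zero]
  exact ENat.ne_top_iff_exists.1 (ne_top_of_le_ne_top (ENat.natCast_ne_top p) hle) |>.imp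
    fun _ h => h.symm

/-- On the finite dimensional invariant space K = N(A^p), the restriction of A has kernel and
cokernel of equal dimension. The kernel contains N(A); the cokernel embeds in X/R(A), because Ax ∈ K
already forces x ∈ K. -/
theorem HasFiniteAscent.alpha_le_beta {A : X →L[ℂ] X} (h : HasFiniteAscent A)
    (hf : FiniteDimensional ℂ (ker A)) : alpha A ≤ beta A := by
  obtain ⟨p, hp⟩ := h
  have hK := finiteDimensional_ker_pow hf p
  set K := ker (A ^ p) with hKdef
  have hinv : ∀ x ∈ K, (A : X →ₗ[ℂ] X) x ∈ K := fun x hx => by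
    change (A ^ p) (A x) = 0
    have h0 : (A ^ p) x = 0 := hx
    have h1 : (A ^ p * A) x = (A * A ^ p) x := by rw [← pow_succ, ← pow_succ']
    calc (A ^ p) (A x) = A ((A ^ p) x) := h1
      _ = 0 := by rw [h0, map_zero]
  let g : K →ₗ[ℂ] K := (A : X →ₗ[ℂ] X).restrict hinv
  have hmap : LinearMap.range g ≤ (range A).comap K.subtype := by
    rintro _ ⟨x, rfl⟩
    exact ⟨x, rfl⟩
  let q : (K ⧸ LinearMap.range g) →ₗ[ℂ] (X ⧸ range A) := Submodule.mapQ _ _ K.subtype hmap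
  have hq : Function.Injective q := by
    rw [injective_iff_map_eq_zero]
    intro k
    obtain ⟨k, rfl⟩ := Submodule.Quotient.mk_surjective _ k
    intro hk
    obtain ⟨x, hx⟩ : (k : X) ∈ range A := (Submodule.Quotient.mk_eq_zero _).1 hk
    have hxK : x ∈ K := hp (p + 1) (by
      have h0 : (A ^ p) (k : X) = 0 := k.2
      change (A ^ (p + 1)) x = 0
      rw [pow_succ]
      exact (congrArg (A ^ p) hx).trans h0)
    exact (Submodule.Quotient.mk_eq_zero _).2 ⟨⟨x, hxK⟩, Subtype.ext hx⟩
  let j : ker A →ₗ[ℂ] LinearMap.ker g :=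
    { toFun := fun x => ⟨⟨x, hp 1 (by rw [pow_one]; exact x.2)⟩, Subtype.ext x.2⟩
      map_add' := fun _ _ => rfl
      map_smul' := fun _ _ => rfl }
  have hj : Function.Injective j := fun x y h =>
    Subtype.ext (congrArg (fun z : LinearMap.ker g => ((z : K) : X)) h)
  have hfin : Module.finrank ℂ (LinearMap.ker g) = Module.finrank ℂ (K ⧸ LinearMap.range g) := by
    have h1 := LinearMap.finrank_range_add_finrank_ker g
    have h2 := Submodule.finrank_quotient_add_finrank (LinearMap.range g)
    omega
  have hrank : Module.rank ℂ (ker A) ≤ Module.rank ℂ (X ⧸ range A) := by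
    refine (LinearMap.rank_le_of_injective j hj).trans ?_
    rw [← Module.finrank_eq_rank ℂ (LinearMap.ker g), hfin, Module.finrank_eq_rank]
    exact LinearMap.rank_le_of_injective q hq
  exact (OrderHomClass.mono Cardinal.toENat) hrank

theorem HasFiniteAscent.isUpperSemiWeyl_iff {A : X →L[ℂ] X} (h : HasFiniteAscent A) :
    IsUpperSemiWeyl A ↔ IsUpperSemiFredholm A := by
  refine ⟨fun hA => hA.1, fun hA => ⟨hA, ?_⟩⟩
  have hle := h.alpha_le_beta (alpha_lt_top_iff.1 hA.2)
  refine EReal.sub_nonpos.2 ?_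
  exact_mod_cast hle

/-! ### Bounded below operators and spectra. -/

theorem IsBoundedBelow.injective {A : X →L[ℂ] X} (h : IsBoundedBelow A) :
    Function.Injective A := by
  obtain ⟨c, hc, h⟩ := h
  rw [injective_iff_map_eq_zero]
  intro x hx
  have := h x
  rw [hx, norm_zero] at this
  exact norm_le_zero_iff.1 (nonpos_of_mul_nonpos_right this hc)

theorem ker_eq_bot_iff {A : X →L[ℂ] X} : ker A = ⊥ ↔ Function.Injective A :=
  LinearMap.ker_eq_bot

theorem isBoundedBelow_of_isUnit {A : X →L[ℂ] X} (h : IsUnit A) : IsBoundedBelow A := by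
  obtain ⟨u, rfl⟩ := h
  refine ⟨(‖(↑u⁻¹ : X →L[ℂ] X)‖ + 1)⁻¹, by positivity, fun x => ?_⟩
  rw [inv_mul_le_iff₀ (by positivity)]
  have : x = (↑u⁻¹ : X →L[ℂ] X) ((↑u : X →L[ℂ] X) x) := by
    rw [← mul_apply_eq_comp, Units.inv_mul]; rfl
  calc ‖x‖ = ‖(↑u⁻¹ : X →L[ℂ] X) ((↑u : X →L[ℂ] X) x)‖ := by rw [← this]
    _ ≤ ‖(↑u⁻¹ : X →L[ℂ] X)‖ * ‖(↑u : X →L[ℂ] X) x‖ := ContinuousLinearMap.le_opNorm _ _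
    _ ≤ _ := by gcongr; linarith

theorem isUpperSemiFredholm_of_isBoundedBelow [CompleteSpace X] {A : X →L[ℂ] X}
    (h : IsBoundedBelow A) : IsUpperSemiFredholm A := by
  refine ⟨?_, alpha_lt_top_iff.2 ?_⟩
  · obtain ⟨c, hc, h⟩ := h
    have ha : AntilipschitzWith (Real.toNNReal c⁻¹) A := by
      refine AddMonoidHomClass.antilipschitz_of_bound A fun x => ?_
      rw [Real.coe_toNNReal _ (by positivity), ← div_eq_inv_mul, le_div_iff₀ hc, mul_comm]
      exact h x
    exact ha.isClosed_range A.uniformContinuous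
  · rw [ker_eq_bot_iff.2 h.injective]
    infer_instance

theorem mem_spectrum_iff {A : X →L[ℂ] X} {z : ℂ} :
    z ∈ spectrum ℂ A ↔ ¬ IsUnit (shift A z) := by
  rw [spectrum.mem_iff, IsUnit.sub_iff, Algebra.algebraMap_eq_smul_one]
  rfl

theorem approxSpectrum_subset_spectrum (A : X →L[ℂ] X) : approxSpectrum A ⊆ spectrum ℂ A :=
  fun _ hz => mem_spectrum_iff.2 fun hu => hz (isBoundedBelow_of_isUnit hu)

theorem hasEigenvalue_iff {A : X →L[ℂ] X} {z : ℂ} :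
    Module.End.HasEigenvalue (A : X →ₗ[ℂ] X) z ↔ ¬ Function.Injective (shift A z) := by
  rw [← ker_eq_bot_iff, Module.End.hasEigenvalue_iff, Module.End.eigenspace_def]
  rfl

/-! ### Class (H) and the form of property (az). -/

theorem mem_quasinilpotentPart_of_mem_ker_pow {A : X →L[ℂ] X} {n : ℕ} {x : X}
    (hx : x ∈ ker (A ^ n)) : x ∈ quasinilpotentPart A := by
  refine tendsto_const_nhds.congr' ?_
  -- m = 0 is excluded because there the exponent 1/m is 0 and 0^0 = 1.
  filter_upwards [eventually_ge_atTop n, eventually_gt_atTop 0] with m hm hm0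
  have h0 : (A ^ n) x = 0 := hx
  have : (A ^ m) x = 0 := by
    rw [← Nat.sub_add_cancel hm, pow_add, mul_apply_eq_comp, h0, map_zero]
  rw [this, norm_zero, Real.zero_rpow (by positivity)]

theorem ClassH.hasFiniteAscent {A : X →L[ℂ] X} (h : ClassH A) (z : ℂ) :
    HasFiniteAscent (shift A z) := by
  obtain ⟨p, hp⟩ := h z
  refine ⟨p, fun n x hx => ?_⟩
  have := mem_quasinilpotentPart_of_mem_ker_pow hx
  rwa [hp] at this

theorem mem_p00a_iff [CompleteSpace X] {A : X →L[ℂ] X} {z : ℂ} (h : HasFiniteAscent (shift A z)) :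
    z ∈ p00a A ↔ z ∈ approxSpectrum A ∧ IsUpperSemiFredholm (shift A z) := by
  constructor
  · rintro ⟨⟨hz, p, -, hp⟩, hα⟩
    exact ⟨hz, isClosed_range_of_isClosed_range_pow_succ (alpha_lt_top_iff.1 hα) hp, hα⟩
  · rintro ⟨hz, hA⟩
    obtain ⟨p, hp⟩ := h.exists_ascent_eq
    exact ⟨⟨hz, p, hp, (hA.pow _).1⟩, hA.2⟩

theorem mem_spectrum_diff_iff {A : X →L[ℂ] X} (h : ∀ z, HasFiniteAscent (shift A z)) {z : ℂ} :
    z ∈ spectrum ℂ A \ upperSemiWeylSpectrum A ↔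
      z ∈ spectrum ℂ A ∧ IsUpperSemiFredholm (shift A z) := by
  rw [← (h z).isUpperSemiWeyl_iff]
  simp [upperSemiWeylSpectrum]

/-- A spectral point outside σ_a would be bounded below, hence upper semi-Fredholm, so the inclusion
would put it in σ_a. -/
theorem approxSpectrum_eq_spectrum_of_subset [CompleteSpace X] {A : X →L[ℂ] X}
    (h : ∀ z, HasFiniteAscent (shift A z))
    (hA : spectrum ℂ A \ upperSemiWeylSpectrum A ⊆ approxSpectrum A) :
    approxSpectrum A = spectrum ℂ A := by
  refine (approxSpectrum_subset_spectrum A).antisymm fun z hz => ?_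
  by_contra hn
  exact hn (hA ((mem_spectrum_diff_iff h).2
    ⟨hz, isUpperSemiFredholm_of_isBoundedBelow (not_not.1 hn)⟩))

theorem propertyAZ_iff [CompleteSpace X] {A : X →L[ℂ] X} (h : ∀ z, HasFiniteAscent (shift A z)) :
    PropertyAZ A ↔ approxSpectrum A = spectrum ℂ A := by
  constructor
  · intro hA
    refine approxSpectrum_eq_spectrum_of_subset h ?_
    rw [hA]
    exact fun z hz => hz.1.1
  · intro hA
    ext z
    rw [mem_spectrum_diff_iff h, mem_p00a_iff (h z), hA]

/-! ### The Riesz projection at an isolated spectral point. -/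

theorem mul_circleIntegral [CompleteSpace X] (A : X →L[ℂ] X) {f : ℂ → X →L[ℂ] X} {c : ℂ} {r : ℝ}
    (hf : CircleIntegrable f c r) :
    A * (∮ z in C(c, r), f z) = ∮ z in C(c, r), A * f z := by
  have h := (ContinuousLinearMap.mul ℂ (X →L[ℂ] X) A).intervalIntegral_comp_comm hf.out
  simp only [circleIntegral, ContinuousLinearMap.mul_apply', mul_smul_comm] at *
  exact h.symm

theorem shift_mul_resolvent (A : X →L[ℂ] X) {c z : ℂ} (hz : z ∈ resolventSet ℂ A) :
    shift A c * resolvent A z = (z - c) • resolvent A z - 1 := by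
  have h : (algebraMap ℂ (X →L[ℂ] X) z - A) * resolvent A z = 1 := Ring.mul_inverse_cancel _ hz
  rw [Algebra.algebraMap_eq_smul_one, sub_mul, smul_mul_assoc, one_mul] at h
  rw [shift, sub_mul, smul_mul_assoc, one_mul, ← h, sub_smul]
  abel

section

variable [CompleteSpace X] {A : X →L[ℂ] X} {c : ℂ} {ε : ℝ}

theorem continuousOn_resolvent : ContinuousOn (resolvent A) (resolventSet ℂ A) := fun _ hz =>
  (spectrum.hasDerivAt_resolvent_const_left hz).continuousAt.continuousWithinAt

/-- Each factor A - c becomes z - c under the integral, up to a polynomial term whose circle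
integral vanishes. -/
theorem shift_pow_mul_circleIntegral_resolvent {r : ℝ} (hr : 0 < r)
    (hA : Metric.sphere c r ⊆ resolventSet ℂ A) (n : ℕ) :
    shift A c ^ n * (∮ z in C(c, r), resolvent A z) =
      ∮ z in C(c, r), (z - c) ^ n • resolvent A z := by
  induction n with
  | zero => simp
  | succ n ih =>
    have hR : ContinuousOn (resolvent A) (Metric.sphere c r) := continuousOn_resolvent.mono hA
    have h1 : CircleIntegrable (fun z => (z - c) ^ n • resolvent A z) c r :=
      ContinuousOn.circleIntegrable hr.le (by fun_prop)
    have h2 : CircleIntegrable (fun z => (z - c) ^ (n + 1) • resolvent A z) c r :=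
      ContinuousOn.circleIntegrable hr.le (by fun_prop)
    have h3 : CircleIntegrable (fun z => (z - c) ^ n • (1 : X →L[ℂ] X)) c r :=
      ContinuousOn.circleIntegrable hr.le (by fun_prop)
    have h4 : (∮ z in C(c, r), (z - c) ^ n • (1 : X →L[ℂ] X)) = 0 := by
      rw [circleIntegral.integral_smul_const]
      have := circleIntegral.integral_sub_zpow_of_ne (n := (n : ℤ)) (by omega) c c r
      simp only [zpow_natCast] at this
      rw [this, zero_smul]
    rw [pow_succ', mul_assoc, ih, mul_circleIntegral _ h1]
    rw [circleIntegral.integral_congr (g := fun z => (z - c) ^ (n + 1) • resolvent A z -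
      (z - c) ^ n • (1 : X →L[ℂ] X)) hr.le, circleIntegral.integral_sub h2 h3, h4, sub_zero]
    intro z hz
    change shift A c * ((z - c) ^ n • resolvent A z) = _
    rw [mul_smul_comm, shift_mul_resolvent A (hA hz), smul_sub, smul_smul, ← pow_succ]

/-- If the Riesz projection vanishes, this yields a right inverse of A - c. -/
theorem shift_mul_circleIntegral_inv_smul_resolvent {r : ℝ} (hr : 0 < r)
    (hA : Metric.sphere c r ⊆ resolventSet ℂ A) :
    shift A c * (∮ z in C(c, r), (z - c)⁻¹ • resolvent A z) =
      (∮ z in C(c, r), resolvent A z) - (2 * Real.pi * Complex.I : ℂ) • (1 : X →L[ℂ] X) := by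
  have hR : ContinuousOn (resolvent A) (Metric.sphere c r) := continuousOn_resolvent.mono hA
  have hne : ∀ z ∈ Metric.sphere c r, z - c ≠ 0 := fun z hz => by
    rw [sub_ne_zero]
    rintro rfl
    simp [hr.ne] at hz
  have h1 : CircleIntegrable (fun z => (z - c)⁻¹ • resolvent A z) c r :=
    ContinuousOn.circleIntegrable hr.le (by fun_prop (disch := assumption))
  have h2 : CircleIntegrable (resolvent A) c r := ContinuousOn.circleIntegrable hr.le hR
  have h3 : CircleIntegrable (fun z => (z - c)⁻¹ • (1 : X →L[ℂ] X)) c r :=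
    ContinuousOn.circleIntegrable hr.le (by fun_prop (disch := assumption))
  rw [mul_circleIntegral _ h1, circleIntegral.integral_congr (g := fun z => resolvent A z -
    (z - c)⁻¹ • (1 : X →L[ℂ] X)) hr.le, circleIntegral.integral_sub h2 h3,
    circleIntegral.integral_smul_const, circleIntegral.integral_sub_center_inv _ hr.ne']
  intro z hz
  change shift A c * ((z - c)⁻¹ • resolvent A z) = _
  rw [mul_smul_comm, shift_mul_resolvent A (hA hz), smul_sub, inv_smul_smul₀ (hne z hz)]

theorem circleIntegral_resolvent_eq (hA : Metric.closedBall c ε \ {c} ⊆ resolventSet ℂ A) {r : ℝ}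
    (hr : 0 < r) (hrε : r ≤ ε) :
    (∮ z in C(c, ε), resolvent A z) = ∮ z in C(c, r), resolvent A z := by
  refine Complex.circleIntegral_eq_of_differentiable_on_annulus_off_countable hr hrε
    Set.countable_empty (continuousOn_resolvent.mono fun z hz => hA ⟨hz.1, ?_⟩) fun z hz =>
    (spectrum.hasDerivAt_resolvent_const_left
      (hA ⟨Metric.ball_subset_closedBall hz.1.1, ?_⟩)).differentiableAt
  · rintro rfl
    exact hz.2 (Metric.mem_ball_self hr)
  · rintro rfl
    exact hz.1.2 (Metric.mem_closedBall_self hr.le)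

/-- The contour can be shrunk to any radius r, giving a bound C_r r^n for the n-th iterate; its n-th
roots are eventually below any δ > r. -/
theorem circleIntegral_resolvent_apply_mem_quasinilpotentPart (hε : 0 < ε)
    (hA : Metric.closedBall c ε \ {c} ⊆ resolventSet ℂ A) (x : X) :
    (∮ z in C(c, ε), resolvent A z) x ∈ quasinilpotentPart (shift A c) := by
  -- The strict form n > N guarantees n ≠ 0, needed to take n-th roots.
  refine Metric.tendsto_atTop'.2 fun δ hδ => ?_
  obtain ⟨r, hr0, hrε, hrδ⟩ : ∃ r : ℝ, 0 < r ∧ r ≤ ε ∧ r < δ :=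
    ⟨min ε (δ / 2), by positivity, min_le_left _ _, (min_le_right _ _).trans_lt (by linarith)⟩
  have hsph : Metric.sphere c r ⊆ resolventSet ℂ A := fun z hz => hA
    ⟨Metric.closedBall_subset_closedBall hrε (Metric.sphere_subset_closedBall hz), by
      rintro rfl
      simp [hr0.ne] at hz⟩
  obtain ⟨M, hM⟩ := (isCompact_sphere c r).exists_bound_of_continuousOn
    (continuousOn_resolvent.mono hsph)
  have hM0 : 0 ≤ M := by
    obtain ⟨z, hz⟩ := (NormedSpace.sphere_nonempty (x := c)).2 hr0.le
    exact (norm_nonneg _).trans (hM z hz)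
  rw [circleIntegral_resolvent_eq hA hr0 hrε]
  have hbound : ∀ n : ℕ, ‖(shift A c ^ n) ((∮ z in C(c, r), resolvent A z) x)‖ ≤
      (2 * Real.pi * r * M * ‖x‖) * r ^ n := fun n => by
    rw [← mul_apply_eq_comp, shift_pow_mul_circleIntegral_resolvent hr0 hsph]
    refine (ContinuousLinearMap.le_opNorm _ _).trans ?_
    have := circleIntegral.norm_integral_le_of_norm_le_const (C := r ^ n * M) hr0.le
      (f := fun z => (z - c) ^ n • resolvent A z) (c := c) fun z hz => by
        rw [norm_smul, norm_pow, mem_sphere_iff_norm.1 hz]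
        gcongr
        exact hM z hz
    calc _ ≤ 2 * Real.pi * r * (r ^ n * M) * ‖x‖ := by gcongr
      _ = _ := by ring
  have hlim : Tendsto (fun n : ℕ => (2 * Real.pi * r * M * ‖x‖) * (r / δ) ^ n) atTop (𝓝 0) := by
    have := (tendsto_pow_atTop_nhds_zero_of_lt_one (r := r / δ) (by positivity)
      ((div_lt_one hδ).2 hrδ)).const_mul (2 * Real.pi * r * M * ‖x‖)
    rwa [mul_zero] at this
  obtain ⟨N, hN⟩ := eventually_atTop.1 (hlim.eventually_lt_const one_pos)
  refine ⟨N, fun n hn => ?_⟩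
  have hn0 : n ≠ 0 := by omega
  have h1 : ‖(shift A c ^ n) ((∮ z in C(c, r), resolvent A z) x)‖ < δ ^ n := by
    refine (hbound n).trans_lt ?_
    have := hN n hn.le
    rwa [div_pow, ← mul_div_assoc, div_lt_one (by positivity)] at this
  rw [Real.dist_eq, sub_zero, abs_of_nonneg (by positivity)]
  calc _ < (δ ^ n) ^ (1 / (n : ℝ)) := Real.rpow_lt_rpow (norm_nonneg _) h1 (by positivity)
    _ = δ := by rw [one_div, Real.pow_rpow_inv_natCast hδ.le hn0]

/-- An isolated point of the spectrum at which `A - c` is injective has a nontrivial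
quasinilpotent part. -/
theorem exists_ne_zero_mem_quasinilpotentPart (hc : c ∈ isoPoints (spectrum ℂ A))
    (hinj : Function.Injective (shift A c)) :
    ∃ x ≠ 0, x ∈ quasinilpotentPart (shift A c) := by
  obtain ⟨hc, hacc⟩ := hc
  obtain ⟨ε, hε, hA⟩ : ∃ ε > 0, Metric.closedBall c ε \ {c} ⊆ resolventSet ℂ A := by
    rw [accPt_iff_nhds] at hacc
    push Not at hacc
    obtain ⟨U, hU, h⟩ := hacc
    obtain ⟨ε, hε, hεU⟩ := Metric.nhds_basis_closedBall.mem_iff.1 hU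
    refine ⟨ε, hε, fun z hz => ?_⟩
    by_contra hz'
    exact hz.2 (h z ⟨hεU hz.1, hz'⟩)
  have hsph : Metric.sphere c ε ⊆ resolventSet ℂ A := fun z hz => hA
    ⟨Metric.sphere_subset_closedBall hz, by rintro rfl; simp [hε.ne] at hz⟩
  by_contra! hcon
  have hP : (∮ z in C(c, ε), resolvent A z) = 0 := by
    ext x
    by_contra hx
    exact hcon _ hx (circleIntegral_resolvent_apply_mem_quasinilpotentPart hε hA x)
  have hB := shift_mul_circleIntegral_inv_smul_resolvent hε hsph
  rw [hP, zero_sub] at hB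
  set B := ∮ z in C(c, ε), (z - c)⁻¹ • resolvent A z
  have hu : IsUnit (shift A c) := by
    refine ContinuousLinearMap.isUnit_iff_bijective.2 ⟨hinj, fun y => ?_⟩
    refine ⟨B (-(2 * Real.pi * Complex.I : ℂ)⁻¹ • y), ?_⟩
    rw [← mul_apply_eq_comp, hB]
    simp only [neg_smul, map_neg, neg_apply, smul_apply,
      one_apply_eq_self, neg_neg]
    exact smul_inv_smul₀ Complex.two_pi_I_ne_zero y
  refine hc ?_
  rw [spectrum.mem_resolventSet_iff, IsUnit.sub_iff, Algebra.algebraMap_eq_smul_one]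
  exact hu

end

/-! ### Isolated spectral points and the form of property (z). -/

/-- Isolated spectral points of operators of class `(H)` are eigenvalues. -/
theorem ClassH.not_injective_of_mem_isoPoints [CompleteSpace X] {A : X →L[ℂ] X} (h : ClassH A)
    {z : ℂ} (hz : z ∈ isoPoints (spectrum ℂ A)) : ¬ Function.Injective (shift A z) := by
  intro hinj
  obtain ⟨x, hx0, hx⟩ := exists_ne_zero_mem_quasinilpotentPart hz hinj
  obtain ⟨p, hp⟩ := h z
  rw [hp] at hx
  have hinjp : Function.Injective (shift A z ^ p) := by
    rw [FunLike.coe_pow_eq_iterate]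
    exact hinj.iterate p
  exact hx0 (hinjp (hx.trans (map_zero _).symm))

theorem not_accPt_spectrum_of_notMem [CompleteSpace X] {A : X →L[ℂ] X} {z : ℂ}
    (hz : z ∉ spectrum ℂ A) : ¬ AccPt z (𝓟 (spectrum ℂ A)) :=
  fun h => hz (isClosed_iff_accPt.1 (spectrum.isClosed A) z h)

theorem propertyZ_iff [CompleteSpace X] {A : X →L[ℂ] X} (h : ∀ z, HasFiniteAscent (shift A z)) :
    PropertyZ A ↔ approxSpectrum A = spectrum ℂ A ∧
      ∀ z, (z ∈ spectrum ℂ A ∧ IsUpperSemiFredholm (shift A z)) ↔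
        (z ∈ isoPoints (spectrum ℂ A) ∧ ¬ Function.Injective (shift A z) ∧
          alpha (shift A z) < ⊤) := by
  have key : approxSpectrum A = spectrum ℂ A → (PropertyZ A ↔
      ∀ z, (z ∈ spectrum ℂ A ∧ IsUpperSemiFredholm (shift A z)) ↔
        (z ∈ isoPoints (spectrum ℂ A) ∧ ¬ Function.Injective (shift A z) ∧
          alpha (shift A z) < ⊤)) := fun hA => by
    rw [PropertyZ, Set.ext_iff]
    refine forall_congr' fun z => ?_
    rw [mem_spectrum_diff_iff h, pi00a, hA, ← hasEigenvalue_iff]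
    rfl
  refine ⟨fun hA => ?_, fun hA => (key hA.1).2 hA.2⟩
  have hs := approxSpectrum_eq_spectrum_of_subset h (by
    rw [hA]
    exact fun z hz => hz.1.1)
  exact ⟨hs, (key hs).1 hA⟩

/-- For operators of class `(H)` with property `(z)`, being upper semi-Fredholm at `z` amounts to
`z` not accumulating the spectrum and having finite geometric multiplicity. -/
theorem ClassH.not_accPt_and_alpha_lt_top_iff [CompleteSpace X] {A : X →L[ℂ] X} (h : ClassH A)
    (hA : PropertyZ A) (z : ℂ) :
    (¬ AccPt z (𝓟 (spectrum ℂ A)) ∧ alpha (shift A z) < ⊤) ↔ IsUpperSemiFredholm (shift A z) := by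
  obtain ⟨-, hA⟩ := (propertyZ_iff h.hasFiniteAscent).1 hA
  by_cases hz : z ∈ spectrum ℂ A
  · have := hA z
    constructor
    · rintro ⟨h1, h2⟩
      exact (this.2 ⟨⟨hz, h1⟩, h.not_injective_of_mem_isoPoints ⟨hz, h1⟩, h2⟩).2
    · intro h1
      obtain ⟨h2, -, h3⟩ := this.1 ⟨hz, h1⟩
      exact ⟨h2.2, h3⟩
  -- Off the spectrum both sides hold; this covers a summand whose spectrum misses z.
  · have hu := isUpperSemiFredholm_of_isBoundedBelow
      (isBoundedBelow_of_isUnit (not_not.1 (mt mem_spectrum_iff.2 hz)))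
    exact iff_of_true ⟨not_accPt_spectrum_of_notMem hz, hu.2⟩ hu

/-! ### Direct sums. -/

variable {Y : Type*} [NormedAddCommGroup Y] [NormedSpace ℂ Y]
variable {S : X →L[ℂ] X} {T : Y →L[ℂ] Y}

theorem shift_prodMap (z : ℂ) : shift (S.prodMap T) z = (shift S z).prodMap (shift T z) := by
  ext <;> simp [shift]

theorem prodMap_pow (n : ℕ) : S.prodMap T ^ n = (S ^ n).prodMap (T ^ n) := by
  induction n with
  | zero => ext <;> simp
  | succ n ih => rw [pow_succ, ih]; ext <;> simp [pow_succ]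

theorem ker_prodMap : ker (S.prodMap T) = (ker S).prod (ker T) :=
  LinearMap.ker_prodMap (S : X →ₗ[ℂ] X) (T : Y →ₗ[ℂ] Y)

theorem coe_range_prodMap :
    (range (S.prodMap T) : Set (X × Y)) = (range S : Set X) ×ˢ (range T : Set Y) :=
  Set.range_prodMap

theorem ker_pow_mono (A : X →L[ℂ] X) {p q : ℕ} (hpq : p ≤ q) : ker (A ^ p) ≤ ker (A ^ q) :=
  fun x hx => by
    rw [mem_ker_iff] at *
    rw [← Nat.sub_add_cancel hpq, pow_add, mul_apply_eq_comp, hx, map_zero]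

theorem HasFiniteAscent.prodMap (hS : HasFiniteAscent S) (hT : HasFiniteAscent T) :
    HasFiniteAscent (S.prodMap T) := by
  obtain ⟨p, hp⟩ := hS
  obtain ⟨q, hq⟩ := hT
  refine ⟨max p q, fun n => ?_⟩
  rw [prodMap_pow, prodMap_pow, ker_prodMap, ker_prodMap]
  exact Submodule.prod_mono ((hp n).trans (ker_pow_mono _ (le_max_left _ _)))
    ((hq n).trans (ker_pow_mono _ (le_max_right _ _)))

theorem alpha_prodMap_lt_top_iff :
    alpha (S.prodMap T) < ⊤ ↔ alpha S < ⊤ ∧ alpha T < ⊤ := by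
  simp only [alpha_lt_top_iff]
  simp only [FiniteDimensional, Module.Finite.iff_fg, ker_prodMap]
  refine ⟨fun h => ⟨?_, ?_⟩, fun h => h.1.prod h.2⟩
  · have := h.map (LinearMap.fst ℂ X Y)
    rwa [Submodule.prod_map_fst] at this
  · have := h.map (LinearMap.snd ℂ X Y)
    rwa [Submodule.prod_map_snd] at this

theorem isUpperSemiFredholm_prodMap_iff :
    IsUpperSemiFredholm (S.prodMap T) ↔ IsUpperSemiFredholm S ∧ IsUpperSemiFredholm T := by
  simp only [IsUpperSemiFredholm, coe_range_prodMap, alpha_prodMap_lt_top_iff]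
  have : IsClosed ((range S : Set X) ×ˢ (range T : Set Y)) ↔
      IsClosed (range S : Set X) ∧ IsClosed (range T : Set Y) := by
    refine ⟨fun h => ⟨?_, ?_⟩, fun h => h.1.prod h.2⟩
    -- R(S) is the slice of the product at 0 ∈ R(T).
    · convert h.preimage (f := fun x : X => (x, (0 : Y))) (by fun_prop) using 1
      ext x
      simp
    · convert h.preimage (f := fun y : Y => ((0 : X), y)) (by fun_prop) using 1
      ext y
      simp
  rw [this]
  tauto

theorem isUnit_prodMap_iff [CompleteSpace X] [CompleteSpace Y] :
    IsUnit (S.prodMap T) ↔ IsUnit S ∧ IsUnit T := by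
  simp only [ContinuousLinearMap.isUnit_iff_bijective]
  exact Prod.map_bijective

theorem isBoundedBelow_prodMap_iff :
    IsBoundedBelow (S.prodMap T) ↔ IsBoundedBelow S ∧ IsBoundedBelow T := by
  constructor
  · rintro ⟨c, hc, h⟩
    refine ⟨⟨c, hc, fun x => ?_⟩, ⟨c, hc, fun y => ?_⟩⟩
    · simpa [Prod.norm_def] using h (x, 0)
    · simpa [Prod.norm_def] using h (0, y)
  · rintro ⟨⟨c, hc, hS⟩, ⟨d, hd, hT⟩⟩
    refine ⟨min c d, lt_min hc hd, fun x => ?_⟩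
    rw [Prod.norm_def, Prod.norm_def, mul_max_of_nonneg _ _ (by positivity)]
    refine max_le_max (le_trans ?_ (hS x.1)) (le_trans ?_ (hT x.2))
    · gcongr
      exact min_le_left _ _
    · gcongr
      exact min_le_right _ _

theorem approxSpectrum_prodMap :
    approxSpectrum (S.prodMap T) = approxSpectrum S ∪ approxSpectrum T := by
  ext z
  simp only [approxSpectrum, Set.mem_union, Set.mem_ofPred_eq, shift_prodMap,
    isBoundedBelow_prodMap_iff]
  tauto

theorem spectrum_prodMap [CompleteSpace X] [CompleteSpace Y] :
    spectrum ℂ (S.prodMap T) = spectrum ℂ S ∪ spectrum ℂ T := by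
  ext z
  simp only [Set.mem_union, mem_spectrum_iff, shift_prodMap, isUnit_prodMap_iff]
  tauto

theorem ClassH.propertyAZ_prodMap [CompleteSpace X] [CompleteSpace Y] (hS : ClassH S)
    (hT : ClassH T) (hS' : PropertyAZ S) (hT' : PropertyAZ T) : PropertyAZ (S.prodMap T) := by
  rw [propertyAZ_iff hS.hasFiniteAscent] at hS'
  rw [propertyAZ_iff hT.hasFiniteAscent] at hT'
  rw [propertyAZ_iff fun z => by
    rw [shift_prodMap]
    exact (hS.hasFiniteAscent z).prodMap (hT.hasFiniteAscent z)]
  rw [approxSpectrum_prodMap, spectrum_prodMap, hS', hT']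

theorem ClassH.propertyZ_prodMap [CompleteSpace X] [CompleteSpace Y] (hS : ClassH S)
    (hT : ClassH T) (hS' : PropertyZ S) (hT' : PropertyZ T) : PropertyZ (S.prodMap T) := by
  have hSz := (propertyZ_iff hS.hasFiniteAscent).1 hS'
  have hTz := (propertyZ_iff hT.hasFiniteAscent).1 hT'
  rw [propertyZ_iff fun z => by
    rw [shift_prodMap]
    exact (hS.hasFiniteAscent z).prodMap (hT.hasFiniteAscent z)]
  refine ⟨by rw [approxSpectrum_prodMap, spectrum_prodMap, hSz.1, hTz.1], fun z => ?_⟩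
  have hinj : Function.Injective (shift (S.prodMap T) z) ↔
      Function.Injective (shift S z) ∧ Function.Injective (shift T z) := by
    rw [shift_prodMap]
    exact Prod.map_injective (f := shift S z) (g := shift T z)
  have hacc : AccPt z (𝓟 (spectrum ℂ (S.prodMap T))) ↔
      AccPt z (𝓟 (spectrum ℂ S)) ∨ AccPt z (𝓟 (spectrum ℂ T)) := by
    rw [spectrum_prodMap, ← sup_principal, accPt_sup]
  have hmem : z ∈ spectrum ℂ (S.prodMap T) ↔ z ∈ spectrum ℂ S ∨ z ∈ spectrum ℂ T := by
    rw [spectrum_prodMap, Set.mem_union]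
  have h1 := hS.not_accPt_and_alpha_lt_top_iff hS' z
  have h2 := hT.not_accPt_and_alpha_lt_top_iff hT' z
  have h3 := (hSz.2 z).1
  have h4 := (hTz.2 z).1
  rw [hinj, isoPoints, Set.mem_ofPred_eq, hacc, hmem, shift_prodMap,
    isUpperSemiFredholm_prodMap_iff, alpha_prodMap_lt_top_iff]
  constructor
  · rintro ⟨hz, hc, hd⟩
    refine ⟨⟨hz, fun h => h.elim (h1.2 hc).1 (h2.2 hd).1⟩, ?_, (h1.2 hc).2, (h2.2 hd).2⟩
    -- Property (z) of whichever summand has z in its spectrum makes that summand non-injective at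
    -- z.
    rintro ⟨hi, hj⟩
    exact hz.elim (fun ha => (h3 ⟨ha, hc⟩).2.1 hi) fun hb => (h4 ⟨hb, hd⟩).2.1 hj
  · rintro ⟨⟨hz, hn⟩, -, hαS, hαT⟩
    rw [not_or] at hn
    exact ⟨hz, h1.1 ⟨hn.1, hαS⟩, h2.1 ⟨hn.2, hαT⟩⟩

end BddOp

theorem proposition4p2
    {X : Type*} [NormedAddCommGroup X] [NormedSpace ℂ X] [CompleteSpace X]
    {Y : Type*} [NormedAddCommGroup Y] [NormedSpace ℂ Y] [CompleteSpace Y]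
    (S : X →L[ℂ] X) (T : Y →L[ℂ] Y)
    (hS : BddOp.ClassH S) (hT : BddOp.ClassH T) :
    (BddOp.PropertyAZ S → BddOp.PropertyAZ T →
      BddOp.PropertyAZ (ContinuousLinearMap.prodMap S T)) ∧
    (BddOp.PropertyZ S → BddOp.PropertyZ T →
      BddOp.PropertyZ (ContinuousLinearMap.prodMap S T)) :=
  ⟨hS.propertyAZ_prodMap hT, hS.propertyZ_prodMap hT⟩
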